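/- Let $\mathbb T=\mathbb R/\mathbb Z$, let $\omega\in\mathbb R\setminus\mathbb Q$, let $p_n/q_n$ be the continued fraction approximants of $\omega$, and let $Rx=x+\omega$ on $\mathbb T$. Write $\|h\|_\infty=\sup_{\theta\in\mathbb T}|h(\theta)|$ for bounded $h:\mathbb T\to\mathbb C$. For $g:\mathbb T\to\mathbb C$ and $z\in\mathbb C$ let $$A^{g,z}(\theta)=\begin{pmatrix} z-g(\theta)&-1\\1&0\end{pmatrix},\qquad A^{g,z}_k(\theta)=A^{g,z}(R^{k-1}\theta)\cdots A^{g,z}(R\theta)A^{g,z}(\theta),\qquad A^{g,z}_0=I .$$ Let $\gamma>0$ and let $f:\mathbb T\to\mathbb R$ belong to $PL_\gamma(\mathbb T)$: the set $J_f$ of discontinuities of $f$ is finite, and $$\|f\|_\infty+\sup_{h>0}\ \sup_{t\in\mathbb T,\ \mathrm{dist}(t,J_f)>h}\frac{|f(t+h)-f(t)|}{h^\gamma}<\infty .$$ For $z\in\mathbb C$ let $\mathcal L(z)=\lim_{k}\frac1k\int_{\mathbb T}\ln\|A^{f,z}_k(\theta)\|\,d\theta=\inf_{k\ge1}\frac1k\int_{\mathbb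 T}\ln\|A^{f,z}_k(\theta)\|\,d\theta$ be the Lyapunov exponent, where $\|\cdot\|$ is the operator norm on $2\times2$ matrices. (a) Let $E\in\mathbb C$ with $\mathcal L(E)>0$. For every $\tau>0$ there is $k_\tau=k_\tau(E)<\infty$ such that for every $n\ge1$ with $q_n>e^{k_\tau\tau\mathcal L(E)/\gamma}$, every positive integer $k$ with $$k_\tau<k<\frac{\gamma}{\tau\mathcal L(E)}\ln q_n,$$ and every $\theta\in\mathbb T$, there is an integer $0<x\le q_n+q_{n-1}-1$ such that $$\|A^{g,z}_k(R^x\theta)\|\ge e^{k(1-\tau)\mathcal L(E)}$$ for all $z\in\mathbb C$ with $|z-E|<e^{-\tau k\mathcal L(E)}$ and all bounded $g:\mathbb T\to\mathbb C$ with $\|g-f\|_\infty<e^{-\tau k\mathcal L(E)}$. (b) If $U\subset\mathbb C$ is compact, $\mathcal L>0$ on $U$ and $\mathcal L$ is continuous on $U$, then for every $\tau>0$ the number $k_\tau$ in (a) can be chosen to be the same for all $E\in U$. -/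

import Mathlib

open scoped Matrix.Norms.L2Operator

noncomputable section

namespace RoughSchrodinger

/-- The supremum norm `sup_θ |h θ|` on the circle `ℝ/ℤ`; sets of measure zero are not
dismissed. It is used for bounded functions only. -/
def supNorm (h : UnitAddCircle → ℂ) : ℝ := ⨆ θ, ‖h θ‖

/-- The set `J_f` of discontinuities of `f`. -/
def discontinuities (f : UnitAddCircle → ℝ) : Set UnitAddCircle := {t | ¬ ContinuousAt f t}

/-- The class `PL_γ(𝕋)`: `f` has finitely many discontinuities, is bounded, and the supremum of
`|f (t + h) - f t| / h ^ γ` over all `h > 0` and all `t` with `dist (t, J_f) > h` is finite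
(the condition on `t` is void when `J_f` is empty). -/
structure IsPiecewiseLipschitz (γ : ℝ) (f : UnitAddCircle → ℝ) : Prop where
  finite_discontinuities : (discontinuities f).Finite
  bounded : BddAbove (Set.range fun t => |f t|)
  lipschitz : ∃ C : ℝ, ∀ (t : UnitAddCircle) (h : ℝ), 0 < h →
    (∀ p ∈ discontinuities f, h < dist t p) →
      |f (t + (h : UnitAddCircle)) - f t| / h ^ γ ≤ C

/-- The transfer matrix `A^{g,z}(θ)`. -/
def transferMatrix (g : UnitAddCircle → ℂ) (z : ℂ) (θ : UnitAddCircle) :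
    Matrix (Fin 2) (Fin 2) ℂ :=
  !![z - g θ, -1; 1, 0]

/-- The iterates `A_k^{g,z}(θ) = A^{g,z}(θ + (k-1)ω) ⋯ A^{g,z}(θ + ω) A^{g,z}(θ)`, `A_0 = I`,
of the Schrödinger cocycle over the rotation by `ω`. -/
def cocycle (ω : ℝ) (g : UnitAddCircle → ℂ) (z : ℂ) : ℕ → UnitAddCircle →
    Matrix (Fin 2) (Fin 2) ℂ
  | 0, _ => 1
  | k + 1, θ => transferMatrix g z (θ + k • (ω : UnitAddCircle)) * cocycle ω g z k θ

/-- The Lyapunov exponent `𝓛(z) = inf_{k ≥ 1} (1/k) ∫ ln ‖A_k^{f,z}(θ)‖ dθ`, for the normalized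
Lebesgue measure on `ℝ/ℤ` and the operator norm coming from the Euclidean norm of `ℂ²`. -/
def lyapunov (ω : ℝ) (f : UnitAddCircle → ℝ) (z : ℂ) : ℝ :=
  sInf ((fun k : ℕ => (∫ θ, Real.log ‖cocycle ω (fun t => (f t : ℂ)) z k θ‖) / k) '' Set.Ici 1)

/-- The denominator `q_n` of the `n`-th continued fraction approximant of `ω`
(`q_0 = 1`, `q_1 = a_1`, `q_{n+1} = a_{n+1} q_n + q_{n-1}`). -/
def approxDen (ω : ℝ) (n : ℕ) : ℝ := (GenContFract.of ω).dens n

/-- `K` is an admissible threshold `k_τ` at the energy `E`: for all `n ≥ 1` with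
`q_n > exp (K τ 𝓛(E) / γ)`, all positive integers `k` with
`K < k < (γ / (τ 𝓛(E))) ln q_n` and all `θ`, there is `0 < x ≤ q_n + q_{n-1} - 1` such that
`‖A_k^{g,z}(R^x θ)‖ ≥ exp (k (1 - τ) 𝓛(E))` for all `z` and all bounded `g` whose distances to
`E` and `f` are less than `exp (-τ k 𝓛(E))`. -/
def IsThreshold (ω γ : ℝ) (f : UnitAddCircle → ℝ) (τ : ℝ) (E : ℂ) (K : ℕ) : Prop :=
  ∀ n : ℕ, 1 ≤ n → Real.exp (K * τ * lyapunov ω f E / γ) < approxDen ω n →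
  ∀ k : ℕ, 0 < k → K < k → (k : ℝ) < γ / (τ * lyapunov ω f E) * Real.log (approxDen ω n) →
  ∀ θ : UnitAddCircle,
  ∃ x : ℕ, 0 < x ∧ (x : ℝ) ≤ approxDen ω n + approxDen ω (n - 1) - 1 ∧
    ∀ z : ℂ, ‖z - E‖ < Real.exp (-(τ * k * lyapunov ω f E)) →
    ∀ g : UnitAddCircle → ℂ, BddAbove (Set.range fun t => ‖g t‖) →
      supNorm (fun t => g t - (f t : ℂ)) < Real.exp (-(τ * k * lyapunov ω f E)) →
      Real.exp (k * (1 - τ) * lyapunov ω f E) ≤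
        ‖cocycle ω g z k (θ + x • (ω : UnitAddCircle))‖

end RoughSchrodinger

end

noncomputable section

namespace RoughSchrodinger

open MeasureTheory Filter Topology

/-! Write L for the exponent at E and ε for a small fraction of τ. Three facts combine. Upper bound:
with finitely many discontinuities, log‖A_k‖ has continuous majorants of almost the same integral.
Weyl equidistribution and subadditivity then bound ‖A_m‖ by e^{m(1+ε)L} at every phase for one m.
For fixed m this survives small changes of z and g, and iterating blocks gives C e^{k(1+ε)L} for all
k (`exists_norm_cocycle_le`). Lower bound: the mean of log‖A_k‖ is at least kL, while the phases
whose first k iterates come within 4/q_n of J_f have measure O(k/q_n), which is exponentially small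
in k as q_n > e^{τkL/γ}. Hence some phase θ₀ avoids J_f and has ‖A_k(θ₀)‖ ≥ e^{k(1-ε)L}
(`exists_good_phase`). Transfer: every orbit comes within 2/q_n of θ₀ in at most q_n steps
(`exists_orbit_near`). Along the two segments f differs by O(q_n^{-γ}) = O(e^{-τkL}), the same size
as the allowed changes of z and g. By telescoping (`norm_stepProd_sub_le`) the matrices differ by at
most O(k e^{k(1+ε-τ)L}), negligible against e^{k(1-ε)L} (`exp_add_error_le`). All constants are
uniform on a compact set where L is positive and continuous; the pointwise statement is the case of
a singleton. -/

/-! ### Continued fractions and density of finite orbits -/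

lemma exists_int_contsAux (ω : ℝ) (n : ℕ) :
    (∃ a b : ℤ, (GenContFract.of ω).contsAux n = ⟨a, b⟩) ∧
      ∃ a b : ℤ, (GenContFract.of ω).contsAux (n + 1) = ⟨a, b⟩ := by
  induction n with
  | zero =>
    refine ⟨⟨1, 0, ?_⟩, ⟨⌊ω⌋, 1, ?_⟩⟩
    · simp [GenContFract.contsAux]
    · simp [GenContFract.contsAux, GenContFract.of_h_eq_floor]
  | succ n ih =>
    refine ⟨ih.2, ?_⟩
    obtain ⟨⟨a, b, h0⟩, a', b', h1⟩ := ih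
    cases hs : (GenContFract.of ω).s.get? n with
    | none =>
      refine ⟨a', b', ?_⟩
      rw [← h1]
      simp [GenContFract.contsAux, hs]
    | some gp =>
      obtain ⟨ha, z, hz⟩ := GenContFract.of_partNum_eq_one_and_exists_int_partDen_eq hs
      refine ⟨z * a' + a, z * b' + b, ?_⟩
      rw [GenContFract.contsAux_recurrence hs h0 h1, ha, hz]
      push_cast
      simp

lemma not_terminatedAt_of_irrational {ω : ℝ} (hω : Irrational ω) (n : ℕ) :
    ¬ (GenContFract.of ω).TerminatedAt n := by
  intro h
  obtain ⟨q, hq⟩ := (GenContFract.terminates_iff_rat ω).1 ⟨n, h⟩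
  exact hω ⟨q, hq.symm⟩

lemma one_le_approxDen (ω : ℝ) (n : ℕ) : 1 ≤ approxDen ω n := by
  induction n with
  | zero => simp [approxDen, GenContFract.zeroth_den_eq_one]
  | succ n ih => exact ih.trans GenContFract.of_den_mono

/-- The determinant identity for consecutive convergents gives coprimality; the error 1/(q_n
q_{n+1}) is at most 1/q_n² since denominators increase. -/
lemma exists_coprime_approx {ω : ℝ} (hω : Irrational ω) (n : ℕ) :
    ∃ (p : ℤ) (q : ℕ), 0 < q ∧ approxDen ω n = q ∧ IsCoprime p (q : ℤ) ∧
      |ω - p / q| ≤ 1 / (q : ℝ) ^ 2 := by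
  obtain ⟨⟨a, b, h0⟩, a', b', h1⟩ := exists_int_contsAux ω (n + 1)
  have hnt := not_terminatedAt_of_irrational hω n
  have hnum : (GenContFract.of ω).nums n = a := by
    rw [GenContFract.num_eq_conts_a, GenContFract.nth_cont_eq_succ_nth_contAux, h0]
  have hden : (GenContFract.of ω).dens n = b := by
    rw [GenContFract.den_eq_conts_b, GenContFract.nth_cont_eq_succ_nth_contAux, h0]
  have hnum' : (GenContFract.of ω).nums (n + 1) = a' := by
    rw [GenContFract.num_eq_conts_a, GenContFract.nth_cont_eq_succ_nth_contAux, h1]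
  have hden' : (GenContFract.of ω).dens (n + 1) = b' := by
    rw [GenContFract.den_eq_conts_b, GenContFract.nth_cont_eq_succ_nth_contAux, h1]
  have hdet : (a : ℝ) * b' - b * a' = (-1) ^ (n + 1) := by
    have := SimpContFract.determinant (s := SimpContFract.of ω) (n := n) hnt
    rw [← hnum, ← hden, ← hnum', ← hden']
    exact this
  have hdet' : a * b' - b * a' = (-1) ^ (n + 1) := by exact_mod_cast hdet
  have hb1 : (1 : ℝ) ≤ b := hden ▸ one_le_approxDen ω n
  have hmono : (b : ℝ) ≤ b' := by
    rw [← hden, ← hden']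
    exact GenContFract.of_den_mono
  have happ := GenContFract.abs_sub_convs_le hnt
  rw [GenContFract.conv_eq_num_div_den, hnum, hden, hden'] at happ
  have hb0 : 0 < b := by
    have : (0 : ℝ) < b := by linarith
    exact_mod_cast this
  lift b to ℕ using hb0.le
  refine ⟨a, b, by exact_mod_cast hb0, by simpa [approxDen] using hden, ?_, ?_⟩
  · refine ⟨(-1) ^ (n + 1) * b', -(-1) ^ (n + 1) * a', ?_⟩
    have : ((-1 : ℤ) ^ (n + 1)) * (-1) ^ (n + 1) = 1 := by
      rw [← mul_pow]; simp
    linear_combination ((-1 : ℤ) ^ (n + 1)) * hdet' + this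
  · simp only [Int.cast_natCast] at happ hb1 hmono
    refine happ.trans ?_
    rw [sq]
    gcongr

/-- Since p is invertible mod q, some x ≤ q puts xp/q mod 1 on the point of (1/q)ℤ nearest to t.
Rounding costs 1/(2q), and replacing p/q by ω costs x/q² ≤ 1/q. -/
lemma exists_orbit_near_real {ω : ℝ} {p : ℤ} {q : ℕ} (hq : 0 < q) (hpq : IsCoprime p (q : ℤ))
    (happ : |ω - p / q| ≤ 1 / (q : ℝ) ^ 2) (t : ℝ) :
    ∃ x : ℕ, 0 < x ∧ x ≤ q ∧ ∃ m : ℤ, |x * ω - t - m| ≤ 2 / q := by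
  obtain ⟨u, v, huv⟩ := hpq
  set s := round (t * q)
  have hs : |t * q - s| ≤ 1 / 2 := abs_sub_round _
  have hqZ : (0 : ℤ) < q := by exact_mod_cast hq
  have hq0 : (0 : ℝ) < q := by exact_mod_cast hq
  -- Reducing su - 1 and adding 1 back gives a residue in [1, q] instead of [0, q - 1], so x is
  -- positive.
  have h1 := Int.emod_nonneg (s * u - 1) hqZ.ne'
  have h2 := Int.emod_lt_of_pos (s * u - 1) hqZ
  have h3 := Int.emod_add_mul_ediv (s * u - 1) q
  set y := (s * u - 1) % (q : ℤ)
  set d := (s * u - 1) / (q : ℤ)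
  lift y to ℕ using h1 with y
  refine ⟨y + 1, by omega, by omega, -(s * v) - d * p, ?_⟩
  have key : ((y : ℤ) + 1) * p = s + (-(s * v) - d * p) * q := by
    linear_combination p * h3 + s * huv
  have keyR : ((y : ℝ) + 1) * p = s + (-(s * v) - d * p) * q := by exact_mod_cast key
  have hid : ((y + 1 : ℕ) : ℝ) * ω - t - ((-(s * v) - d * p : ℤ) : ℝ)
      = ((y : ℝ) + 1) * (ω - p / q) + -((t * q - s) / q) := by
    push_cast
    field_simp
    linear_combination keyR
  rw [hid]
  have hyq : (y : ℝ) + 1 ≤ q := by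
    have : y + 1 ≤ q := by omega
    exact_mod_cast this
  calc _ ≤ |((y : ℝ) + 1) * (ω - p / q)| + |-((t * q - s) / q)| := abs_add_le _ _
    _ = ((y : ℝ) + 1) * |ω - p / q| + |t * q - s| / q := by
        rw [abs_mul, abs_neg, abs_div, abs_of_pos hq0, abs_of_nonneg (by positivity : (0:ℝ) ≤ y + 1)]
    _ ≤ q * (1 / (q : ℝ) ^ 2) + (1 / 2) / q := by gcongr
    _ ≤ 2 / q := by
        rw [show (q : ℝ) * (1 / (q : ℝ) ^ 2) = 1 / q by field_simp, ← add_div]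
        gcongr
        norm_num

lemma norm_coe_le_abs (r : ℝ) : ‖(r : UnitAddCircle)‖ ≤ |r| := by
  rw [UnitAddCircle.norm_eq]
  simpa using round_le r 0

/-- The first `q_n` points of every orbit of an irrational rotation are `2 / q_n`-dense. -/
lemma exists_orbit_near {ω : ℝ} (hω : Irrational ω) (n : ℕ) (θ θ₀ : UnitAddCircle) :
    ∃ x : ℕ, 0 < x ∧ (x : ℝ) ≤ approxDen ω n ∧
      dist θ₀ (θ + x • (ω : UnitAddCircle)) ≤ 2 / approxDen ω n := by
  obtain ⟨p, q, hq, hqn, hpq, happ⟩ := exists_coprime_approx hω n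
  obtain ⟨t, ht⟩ := QuotientAddGroup.mk_surjective (θ₀ - θ)
  obtain ⟨x, hx, hxq, m, hm⟩ := exists_orbit_near_real hq hpq happ t
  refine ⟨x, hx, by rw [hqn]; exact_mod_cast hxq, ?_⟩
  rw [hqn, dist_comm, dist_eq_norm]
  refine le_trans ?_ hm
  have : θ + x • (ω : UnitAddCircle) - θ₀ = ((x * ω - t - m : ℝ) : UnitAddCircle) := by
    have hm0 : ((m : ℝ) : UnitAddCircle) = 0 := by
      rw [AddCircle.coe_eq_zero_iff]
      exact ⟨m, by simp⟩
    have ht' : (t : UnitAddCircle) = θ₀ - θ := ht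
    rw [AddCircle.coe_sub, AddCircle.coe_sub, hm0, ht', ← nsmul_eq_mul, AddCircle.coe_nsmul]
    abel
  rw [this]
  exact norm_coe_le_abs _

/-! ### Two-sided Hölder bound away from the discontinuities -/

lemma exists_coe_eq_abs_eq_norm (y : UnitAddCircle) :
    ∃ r : ℝ, (r : UnitAddCircle) = y ∧ |r| = ‖y‖ := by
  obtain ⟨t, rfl⟩ := QuotientAddGroup.mk_surjective y
  refine ⟨t - round t, ?_, (UnitAddCircle.norm_eq).symm⟩
  have hm0 : ((round t : ℝ) : UnitAddCircle) = 0 := by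
    rw [AddCircle.coe_eq_zero_iff]
    exact ⟨round t, by simp⟩
  rw [AddCircle.coe_sub, hm0, sub_zero]

/-- The defining condition is one-sided: the left endpoint of the increment must be far from J_f.
That endpoint may be y, which the triangle inequality only keeps δ away; hence the margin 2δ at w.
-/
lemma IsPiecewiseLipschitz.exists_holder {γ : ℝ} (hγ : 0 < γ) {f : UnitAddCircle → ℝ}
    (hf : IsPiecewiseLipschitz γ f) :
    ∃ C : ℝ, 0 ≤ C ∧ ∀ (w y : UnitAddCircle) (δ : ℝ), dist w y ≤ δ →
      (∀ p ∈ discontinuities f, 2 * δ < dist w p) → |f w - f y| ≤ C * δ ^ γ := by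
  obtain ⟨C, hC⟩ := hf.lipschitz
  refine ⟨max C 0, le_max_right _ _, fun w y δ hδ hJ => ?_⟩
  obtain ⟨r, hr, hrn⟩ := exists_coe_eq_abs_eq_norm (w - y)
  rw [dist_eq_norm, ← hrn] at hδ
  have hδ0 : 0 ≤ δ := (abs_nonneg r).trans hδ
  have main : ∀ (t : UnitAddCircle) (h : ℝ), 0 < h → h ≤ δ →
      (∀ p ∈ discontinuities f, h < dist t p) → |f (t + (h : UnitAddCircle)) - f t|
        ≤ max C 0 * δ ^ γ := by
    intro t h h0 hhδ hJt
    have := hC t h h0 hJt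
    rw [div_le_iff₀ (by positivity)] at this
    calc _ ≤ C * h ^ γ := this
      _ ≤ max C 0 * h ^ γ := by gcongr; exact le_max_left _ _
      _ ≤ max C 0 * δ ^ γ := by gcongr
  rcases lt_trichotomy r 0 with h | h | h
  · have hy : y = w + ((-r : ℝ) : UnitAddCircle) := by
      rw [AddCircle.coe_neg, hr]; abel
    rw [abs_of_neg h] at hδ
    rw [abs_sub_comm, hy]
    exact main w (-r) (by linarith) hδ fun p hp => by linarith [hJ p hp]
  · have hy : w = y := by
      rw [h, AddCircle.coe_zero] at hr
      exact sub_eq_zero.1 hr.symm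
    rw [hy, sub_self, abs_zero]
    positivity
  · have hy : w = y + (r : UnitAddCircle) := by
      rw [hr]; abel
    have hd : dist w y = |r| := by rw [dist_eq_norm, hrn]
    rw [abs_of_pos h] at hδ hd
    rw [hy]
    refine main y r h hδ fun p hp => ?_
    have := dist_triangle w y p
    linarith [hJ p hp]

/-! ### Products of Schrödinger matrices along arbitrary sequences -/

/-- The one-step Schrödinger matrix. -/
def stepMatrix (w : ℂ) : Matrix (Fin 2) (Fin 2) ℂ := !![w, -1; 1, 0]

/-- The product of the one-step matrices along a sequence. -/
def stepProd (a : ℕ → ℂ) : ℕ → Matrix (Fin 2) (Fin 2) ℂ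
  | 0 => 1
  | k + 1 => stepMatrix (a k) * stepProd a k

lemma cocycle_eq_stepProd (ω : ℝ) (g : UnitAddCircle → ℂ) (z : ℂ) (k : ℕ) (θ : UnitAddCircle) :
    cocycle ω g z k θ = stepProd (fun j => z - g (θ + j • (ω : UnitAddCircle))) k := by
  induction k with
  | zero => rfl
  | succ k ih => rw [cocycle, stepProd, ih]; rfl

lemma stepProd_add (a : ℕ → ℂ) (j k : ℕ) :
    stepProd a (j + k) = stepProd (fun i => a (j + i)) k * stepProd a j := by
  induction k with
  | zero => simp [stepProd]
  | succ k ih => rw [← add_assoc, stepProd, stepProd, ih, mul_assoc]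

lemma stepProd_one_add (a : ℕ → ℂ) (k : ℕ) :
    stepProd a (1 + k) = stepProd (fun i => a (1 + i)) k * stepMatrix (a 0) := by
  rw [stepProd_add]
  simp [stepProd]

lemma norm_stepMatrix_sub_le (w w' : ℂ) : ‖stepMatrix w - stepMatrix w'‖ ≤ ‖w - w'‖ := by
  have : stepMatrix w - stepMatrix w' = Matrix.diagonal ![w - w', 0] := by
    ext i j
    fin_cases i <;> fin_cases j <;> simp [stepMatrix]
  rw [this, Matrix.l2_opNorm_diagonal, pi_norm_le_iff_of_nonneg (norm_nonneg _)]
  intro i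
  fin_cases i <;> simp

lemma norm_stepMatrix_zero : ‖stepMatrix 0‖ = 1 := by
  have h := Matrix.l2_opNorm_conjTranspose_mul_self (stepMatrix 0)
  have h1 : (stepMatrix 0).conjTranspose * stepMatrix 0 = 1 := by
    ext i j
    fin_cases i <;> fin_cases j <;> simp [stepMatrix, Matrix.mul_apply, Fin.sum_univ_two]
  rw [h1, norm_one] at h
  nlinarith [norm_nonneg (stepMatrix 0)]

lemma norm_stepMatrix_le (w : ℂ) : ‖stepMatrix w‖ ≤ ‖w‖ + 1 := by
  have h := norm_stepMatrix_sub_le w 0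
  have h2 := norm_le_norm_add_norm_sub' (stepMatrix w) (stepMatrix 0)
  rw [norm_stepMatrix_zero] at h2
  rw [sub_zero] at h
  linarith

lemma det_stepProd (a : ℕ → ℂ) (k : ℕ) : (stepProd a k).det = 1 := by
  induction k with
  | zero => simp [stepProd]
  | succ k ih => rw [stepProd, Matrix.det_mul, ih]; simp [stepMatrix]

/-- Otherwise the powers of A would tend to 0 while their determinants stay 1. -/
lemma one_le_norm_of_det_eq_one {A : Matrix (Fin 2) (Fin 2) ℂ} (hA : A.det = 1) : 1 ≤ ‖A‖ := by
  by_contra! h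
  have h1 := tendsto_pow_atTop_nhds_zero_of_norm_lt_one h
  have hc : Continuous fun M : Matrix (Fin 2) (Fin 2) ℂ => M.det :=
    Continuous.matrix_det continuous_id
  have h2 := (hc.tendsto 0).comp h1
  have h3 : ((fun M : Matrix (Fin 2) (Fin 2) ℂ => M.det) ∘ fun n : ℕ => A ^ n) = fun _ => 1 := by
    ext n
    simp [hA]
  rw [h3] at h2
  have := tendsto_nhds_unique h2 tendsto_const_nhds
  simp at this

lemma one_le_norm_stepProd (a : ℕ → ℂ) (k : ℕ) : 1 ≤ ‖stepProd a k‖ :=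
  one_le_norm_of_det_eq_one (det_stepProd a k)

lemma norm_stepProd_le_pow {a : ℕ → ℂ} {B : ℝ} (hB : 0 ≤ B) (ha : ∀ i, ‖stepMatrix (a i)‖ ≤ B)
    (k : ℕ) : ‖stepProd a k‖ ≤ B ^ k := by
  induction k with
  | zero => simp [stepProd]
  | succ k ih =>
    rw [stepProd, pow_succ']
    exact (norm_mul_le _ _).trans (mul_le_mul (ha k) ih (norm_nonneg _) hB)

lemma log_norm_stepProd_le {a : ℕ → ℂ} {B : ℝ} (hB : 0 < B) (ha : ∀ i, ‖stepMatrix (a i)‖ ≤ B)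
    (k : ℕ) : Real.log ‖stepProd a k‖ ≤ k * Real.log B := by
  rw [← Real.log_pow]
  exact Real.log_le_log (by linarith [one_le_norm_stepProd a k])
    (norm_stepProd_le_pow hB.le ha k)

lemma log_norm_stepProd_nonneg (a : ℕ → ℂ) (k : ℕ) : 0 ≤ Real.log ‖stepProd a k‖ :=
  Real.log_nonneg (one_le_norm_stepProd a k)

lemma log_norm_stepProd_add_le (a : ℕ → ℂ) (j k : ℕ) :
    Real.log ‖stepProd a (j + k)‖ ≤
      Real.log ‖stepProd (fun i => a (j + i)) k‖ + Real.log ‖stepProd a j‖ := by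
  have h1 := one_le_norm_stepProd a (j + k)
  have h2 := one_le_norm_stepProd a j
  have h3 := one_le_norm_stepProd (fun i => a (j + i)) k
  rw [← Real.log_mul (by linarith) (by linarith)]
  refine Real.log_le_log (by linarith) ?_
  rw [stepProd_add]
  exact norm_mul_le _ _

/-- Telescoping: exchange one factor at a time, with `a` to the left and `b` to the right. The outer
products contribute C² e^{(k-1)Λ}, so the error grows at rate Λ rather than at the rate of the crude
one-step bound. -/
lemma norm_stepProd_sub_le {a b : ℕ → ℂ} {C Λ η : ℝ} (hΛ : 0 ≤ Λ)
    (k : ℕ) (ha : ∀ i m, ‖stepProd (fun j => a (i + j)) m‖ ≤ C * Real.exp (m * Λ))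
    (hb : ∀ m, ‖stepProd b m‖ ≤ C * Real.exp (m * Λ)) (hab : ∀ j < k, ‖a j - b j‖ ≤ η) :
    ‖stepProd a k - stepProd b k‖ ≤ k * (C ^ 2 * Real.exp (k * Λ) * η) := by
  have hC : 0 ≤ C := by
    have := (norm_nonneg _).trans (hb 0)
    simpa using this
  let X : ℕ → Matrix (Fin 2) (Fin 2) ℂ := fun j =>
    stepProd (fun i => a (j + i)) (k - j) * stepProd b j
  have htel := Finset.sum_range_sub X k
  have hX : stepProd b k - stepProd a k = X k - X 0 := by
    simp [X, stepProd]
  rw [norm_sub_rev, hX, ← htel]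
  refine (norm_sum_le _ _).trans ?_
  have hterm : ∀ j ∈ Finset.range k, ‖X (j + 1) - X j‖ ≤ C ^ 2 * Real.exp (k * Λ) * η := by
    intro j hj
    rw [Finset.mem_range] at hj
    obtain ⟨m, rfl⟩ : ∃ m, k = j + (1 + m) := ⟨k - j - 1, by omega⟩
    have e1 : X j = stepProd (fun i => a (j + 1 + i)) m * stepMatrix (a j) * stepProd b j := by
      simp only [X, Nat.add_sub_cancel_left, stepProd_one_add, add_zero, add_assoc]
    have e2 : X (j + 1) = stepProd (fun i => a (j + 1 + i)) m * stepMatrix (b j) * stepProd b j := by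
      simp only [X, stepProd, show j + (1 + m) - (j + 1) = m by omega, mul_assoc]
    have e3 : X (j + 1) - X j = stepProd (fun i => a (j + 1 + i)) m *
        (stepMatrix (b j) - stepMatrix (a j)) * stepProd b j := by
      rw [e1, e2, mul_sub, sub_mul]
    have hη : ‖stepMatrix (b j) - stepMatrix (a j)‖ ≤ η := by
      refine (norm_stepMatrix_sub_le _ _).trans ?_
      rw [norm_sub_rev]
      exact hab j hj
    have hη0 : 0 ≤ η := (norm_nonneg _).trans hη
    rw [e3]
    calc _ ≤ ‖stepProd (fun i => a (j + 1 + i)) m‖ * ‖stepMatrix (b j) - stepMatrix (a j)‖ *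
          ‖stepProd b j‖ := (norm_mul_le _ _).trans (by gcongr; exact norm_mul_le _ _)
      _ ≤ (C * Real.exp (m * Λ)) * η * (C * Real.exp (j * Λ)) := by
          gcongr
          · exact ha _ _
          · exact hb _
      _ = C ^ 2 * Real.exp (m * Λ + j * Λ) * η := by rw [Real.exp_add]; ring
      _ ≤ C ^ 2 * Real.exp (((j + (1 + m) : ℕ) : ℝ) * Λ) * η := by
          gcongr
          push_cast
          nlinarith
  refine (Finset.sum_le_sum hterm).trans ?_
  simp

/-- Blocks of length m are split off until fewer than m factors remain; these cost at most B ^ m. -/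
lemma norm_stepProd_le_of_block {m : ℕ} (hm : 0 < m) {B Λ : ℝ} (hB : 1 ≤ B) (hΛ : 0 ≤ Λ)
    (N : ℕ) : ∀ a : ℕ → ℂ, (∀ i, ‖stepMatrix (a i)‖ ≤ B) →
      (∀ i, ‖stepProd (fun j => a (i + j)) m‖ ≤ Real.exp (m * Λ)) →
      ‖stepProd a N‖ ≤ B ^ m * Real.exp (N * Λ) := by
  induction N using Nat.strong_induction_on with
  | _ N ih =>
    intro a ha hblock
    rcases lt_or_ge N m with h | h
    · calc ‖stepProd a N‖ ≤ B ^ N := norm_stepProd_le_pow (by linarith) ha N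
        _ ≤ B ^ m := pow_le_pow_right₀ hB h.le
        _ ≤ B ^ m * Real.exp (N * Λ) :=
          le_mul_of_one_le_right (by positivity) (Real.one_le_exp (by positivity))
    · obtain ⟨M, rfl⟩ := Nat.exists_eq_add_of_le h
      have h1 := ih M (by omega) (fun i => a (m + i)) (fun i => ha _)
        (fun i => by simpa only [add_assoc] using hblock (m + i))
      have h2 := hblock 0
      simp only [zero_add] at h2
      rw [stepProd_add]
      calc _ ≤ (B ^ m * Real.exp (M * Λ)) * Real.exp (m * Λ) :=
            (norm_mul_le _ _).trans (mul_le_mul h1 h2 (norm_nonneg _) (by positivity))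
        _ = B ^ m * Real.exp (((m + M : ℕ) : ℝ) * Λ) := by
            rw [mul_assoc, ← Real.exp_add]
            push_cast
            ring_nf

/-- Splitting one block of length m off each of the m products uses the starting points 0, …, m - 1
once each and leaves the same sum for the sequence shifted by m. -/
lemma sum_log_norm_stepProd_le (m : ℕ) {B : ℝ} (hB : 1 ≤ B) (N : ℕ) :
    ∀ a : ℕ → ℂ, (∀ i, ‖stepMatrix (a i)‖ ≤ B) →
      ∑ i ∈ Finset.range m, Real.log ‖stepProd (fun j => a (i + j)) (N - i)‖ ≤
        ∑ i ∈ Finset.range N, Real.log ‖stepProd (fun j => a (i + j)) m‖ +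
          m * (2 * m * Real.log B) := by
  induction N using Nat.strong_induction_on with
  | _ N ih =>
    intro a ha
    have hlB : 0 ≤ Real.log B := Real.log_nonneg hB
    -- The cut is at 2m, not m, so that N - m ≥ i for every i < m and the truncated subtractions are
    -- genuine.
    rcases lt_or_ge N (2 * m) with h | h
    · have h1 : ∑ i ∈ Finset.range m, Real.log ‖stepProd (fun j => a (i + j)) (N - i)‖ ≤
          ∑ i ∈ Finset.range m, 2 * m * Real.log B := by
        refine Finset.sum_le_sum fun i _ => ?_
        refine (log_norm_stepProd_le (by linarith) (fun j => ha (i + j)) _).trans ?_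
        gcongr
        have : N - i ≤ 2 * m := by omega
        exact_mod_cast this
      have h2 : 0 ≤ ∑ i ∈ Finset.range N, Real.log ‖stepProd (fun j => a (i + j)) m‖ :=
        Finset.sum_nonneg fun i _ => log_norm_stepProd_nonneg _ _
      simp only [Finset.sum_const, Finset.card_range, nsmul_eq_mul] at h1
      linarith
    · rcases Nat.eq_zero_or_pos m with rfl | hm
      · simp
        exact Finset.sum_nonneg fun i _ => log_norm_stepProd_nonneg _ _
      obtain ⟨M, rfl⟩ : ∃ M, N = m + M := ⟨N - m, by omega⟩
      have h1 := ih M (by omega) (fun i => a (m + i)) (fun i => ha _)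
      rw [Finset.sum_range_add]
      have h2 : ∑ i ∈ Finset.range m, Real.log ‖stepProd (fun j => a (i + j)) (m + M - i)‖ ≤
          ∑ i ∈ Finset.range m, (Real.log ‖stepProd (fun j => a (m + (i + j))) (M - i)‖ +
            Real.log ‖stepProd (fun j => a (i + j)) m‖) := by
        refine Finset.sum_le_sum fun i hi => ?_
        rw [Finset.mem_range] at hi
        have := log_norm_stepProd_add_le (fun j => a (i + j)) m (M - i)
        rw [show m + M - i = m + (M - i) by omega]
        simpa only [add_left_comm i m] using this
      rw [Finset.sum_add_distrib] at h2
      simp only [add_assoc] at h1 h2 ⊢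
      linarith

/-- Averaging the subadditive splittings over all phases. -/
lemma mul_log_norm_stepProd_le {m N : ℕ} (hmN : m ≤ N) {B : ℝ} (hB : 1 ≤ B) {a : ℕ → ℂ}
    (ha : ∀ i, ‖stepMatrix (a i)‖ ≤ B) :
    m * Real.log ‖stepProd a N‖ ≤
      ∑ i ∈ Finset.range N, Real.log ‖stepProd (fun j => a (i + j)) m‖ +
        m * (3 * m * Real.log B) := by
  have hlB : 0 ≤ Real.log B := Real.log_nonneg hB
  have h1 := sum_log_norm_stepProd_le m hB N a ha
  have h2 : ∑ _i ∈ Finset.range m, Real.log ‖stepProd a N‖ ≤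
      ∑ i ∈ Finset.range m, (Real.log ‖stepProd (fun j => a (i + j)) (N - i)‖ +
        m * Real.log B) := by
    refine Finset.sum_le_sum fun i hi => ?_
    rw [Finset.mem_range] at hi
    have h3 := log_norm_stepProd_add_le a i (N - i)
    rw [show i + (N - i) = N by omega] at h3
    have h4 := log_norm_stepProd_le (by linarith) ha i
    have h5 : (i : ℝ) * Real.log B ≤ m * Real.log B := by gcongr
    linarith
  rw [Finset.sum_add_distrib] at h2
  simp only [Finset.sum_const, Finset.card_range, nsmul_eq_mul] at h2
  linarith

/-! ### Weyl equidistribution -/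

instance isProbabilityMeasure_unitAddCircle :
    IsProbabilityMeasure (volume : Measure UnitAddCircle) := ⟨UnitAddCircle.measure_univ⟩

instance nullSingletonClass_unitAddCircle :
    NullSingletonClass (volume : Measure UnitAddCircle) := ⟨fun x => by
  have h := AddCircle.volume_closedBall (T := 1) (x := x) 0
  rw [Metric.closedBall_zero] at h
  rw [h]
  simp⟩

/-- The Birkhoff averages of `F` over the rotation by `ω` converge uniformly to its mean. -/
def HasUniformAverage (ω : ℝ) (F : C(UnitAddCircle, ℂ)) : Prop :=
  ∀ ε : ℝ, 0 < ε → ∃ N₀ : ℕ, ∀ N ≥ N₀, ∀ θ : UnitAddCircle,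
    ‖∑ j ∈ Finset.range N, F (θ + j • (ω : UnitAddCircle)) - N * ∫ t, F t‖ ≤ ε * N

lemma integrable_of_continuousMap (F : C(UnitAddCircle, ℂ)) : Integrable F :=
  F.continuous.integrable_of_hasCompactSupport (HasCompactSupport.of_compactSpace _)

lemma HasUniformAverage.zero (ω : ℝ) : HasUniformAverage ω 0 := by
  intro ε hε
  refine ⟨0, fun N _ θ => ?_⟩
  simp
  positivity

lemma HasUniformAverage.add {ω : ℝ} {F G : C(UnitAddCircle, ℂ)} (hF : HasUniformAverage ω F)
    (hG : HasUniformAverage ω G) : HasUniformAverage ω (F + G) := by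
  intro ε hε
  obtain ⟨N₁, h₁⟩ := hF (ε / 2) (by positivity)
  obtain ⟨N₂, h₂⟩ := hG (ε / 2) (by positivity)
  refine ⟨max N₁ N₂, fun N hN θ => ?_⟩
  have e1 := h₁ N (le_of_max_le_left hN) θ
  have e2 := h₂ N (le_of_max_le_right hN) θ
  have : ∫ t, (F + G) t = (∫ t, F t) + ∫ t, G t :=
    integral_add (integrable_of_continuousMap F) (integrable_of_continuousMap G)
  rw [this]
  simp only [ContinuousMap.add_apply, Finset.sum_add_distrib]
  rw [mul_add, add_sub_add_comm]
  refine (norm_add_le _ _).trans ?_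
  linarith

lemma HasUniformAverage.smul {ω : ℝ} {F : C(UnitAddCircle, ℂ)} (c : ℂ)
    (hF : HasUniformAverage ω F) : HasUniformAverage ω (c • F) := by
  intro ε hε
  obtain ⟨N₁, h₁⟩ := hF (ε / (‖c‖ + 1)) (by positivity)
  refine ⟨N₁, fun N hN θ => ?_⟩
  have e1 := h₁ N hN θ
  have : ∫ t, (c • F) t = c * ∫ t, F t := integral_const_mul c _
  rw [this]
  simp only [ContinuousMap.smul_apply, smul_eq_mul, ← Finset.mul_sum]
  rw [mul_left_comm, ← mul_sub, norm_mul]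
  calc _ ≤ (‖c‖ + 1) * (ε / (‖c‖ + 1) * N) := by
        gcongr
        linarith
    _ = ε * N := by field_simp

lemma fourier_coe_ne_one {ω : ℝ} (hω : Irrational ω) {n : ℤ} (hn : n ≠ 0) :
    fourier n (ω : UnitAddCircle) ≠ 1 := by
  intro h
  have h1 : AddCircle.toCircle (n • (ω : UnitAddCircle)) = 1 := by
    rw [fourier_apply] at h
    exact Circle.ext h
  have h2 : n • (ω : UnitAddCircle) = 0 := by
    apply AddCircle.injective_toCircle (T := 1) one_ne_zero
    rw [h1, AddCircle.toCircle_zero]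
  rw [← AddCircle.coe_zsmul, AddCircle.coe_eq_zero_iff] at h2
  obtain ⟨m, hm⟩ := h2
  simp only [zsmul_eq_mul, mul_one] at hm
  exact (hω.intCast_mul hn).ne_int m hm.symm

lemma fourier_add_nsmul (n : ℤ) (θ α : UnitAddCircle) (j : ℕ) :
    fourier n (θ + j • α) = fourier n θ * fourier n α ^ j := by
  simp only [fourier_apply, smul_add, AddCircle.toCircle_add, Circle.coe_mul]
  rw [smul_comm n j α, AddCircle.toCircle_nsmul, Circle.coe_pow]

/-- For n ≠ 0 the orbit sum is geometric with ratio r ≠ 1, hence bounded by 2/|r - 1| whatever the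
starting point. -/
lemma hasUniformAverage_fourier {ω : ℝ} (hω : Irrational ω) (n : ℤ) :
    HasUniformAverage ω (fourier n) := by
  intro ε hε
  rcases eq_or_ne n 0 with rfl | hn
  · refine ⟨0, fun N _ θ => ?_⟩
    simp
    positivity
  have hint : ∫ t : UnitAddCircle, fourier n t = 0 :=
    integral_eq_zero_of_add_right_eq_neg (fourier_add_half_inv_index hn zero_lt_one)
  set r := fourier n (ω : UnitAddCircle)
  have hr : r ≠ 1 := fourier_coe_ne_one hω hn
  have hr1 : ‖r‖ = 1 := by simp only [r, fourier_apply, Circle.norm_coe]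
  have hr' : 0 < ‖r - 1‖ := norm_pos_iff.2 (sub_ne_zero.2 hr)
  obtain ⟨N₀, hN₀⟩ := exists_nat_gt (2 / ‖r - 1‖ / ε)
  refine ⟨N₀, fun N hN θ => ?_⟩
  have hθ : ‖fourier n θ‖ = 1 := by simp only [fourier_apply, Circle.norm_coe]
  rw [hint, mul_zero, sub_zero]
  simp only [fourier_add_nsmul]
  rw [← Finset.mul_sum, norm_mul, hθ, one_mul, geom_sum_eq hr, norm_div]
  have h2 : ‖r ^ N - 1‖ ≤ 2 := by
    refine (norm_sub_le _ _).trans ?_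
    rw [norm_pow, hr1]
    norm_num
  have h3 : 2 / ‖r - 1‖ < N₀ * ε := (div_lt_iff₀ hε).1 hN₀
  have h4 : (N₀ : ℝ) * ε ≤ N * ε := by gcongr
  calc _ ≤ 2 / ‖r - 1‖ := by gcongr
    _ ≤ ε * N := by linarith

lemma hasUniformAverage_of_mem_span {ω : ℝ} (hω : Irrational ω) {F : C(UnitAddCircle, ℂ)}
    (hF : F ∈ Submodule.span ℂ (Set.range (fourier : ℤ → C(UnitAddCircle, ℂ)))) :
    HasUniformAverage ω F := by
  induction hF using Submodule.span_induction with
  | mem x h => obtain ⟨n, rfl⟩ := h; exact hasUniformAverage_fourier hω n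
  | zero => exact HasUniformAverage.zero ω
  | add x y _ _ hx hy => exact hx.add hy
  | smul c x _ hx => exact hx.smul c

/-- Weyl's equidistribution theorem, uniformly in the starting point. -/
theorem hasUniformAverage {ω : ℝ} (hω : Irrational ω) (F : C(UnitAddCircle, ℂ)) :
    HasUniformAverage ω F := by
  intro ε hε
  have hF : F ∈ (Submodule.span ℂ (Set.range (fourier : ℤ → C(UnitAddCircle, ℂ)))).topologicalClosure := by
    rw [span_fourier_closure_eq_top]
    trivial
  obtain ⟨G, hG, hFG⟩ := Metric.mem_closure_iff.1 hF (ε / 3) (by positivity)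
  obtain ⟨N₀, hN₀⟩ := hasUniformAverage_of_mem_span hω hG (ε / 3) (by positivity)
  refine ⟨N₀, fun N hN θ => ?_⟩
  have hpt : ∀ t, ‖F t - G t‖ ≤ ε / 3 := fun t => by
    rw [← dist_eq_norm]
    exact (ContinuousMap.dist_apply_le_dist t).trans hFG.le
  have h1 := hN₀ N hN θ
  have h2 : ‖∑ j ∈ Finset.range N, (F (θ + j • (ω : UnitAddCircle)) - G (θ + j • (ω : UnitAddCircle)))‖
      ≤ ε / 3 * N := by
    refine (norm_sum_le _ _).trans ((Finset.sum_le_sum fun j _ => hpt _).trans ?_)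
    simp [mul_comm]
  have h3 : ‖∫ t, (F t - G t)‖ ≤ ε / 3 := by
    have := norm_integral_le_of_norm_le_const (μ := (volume : Measure UnitAddCircle))
      (Eventually.of_forall hpt)
    simpa using this
  rw [Finset.sum_sub_distrib] at h2
  rw [integral_sub (integrable_of_continuousMap F) (integrable_of_continuousMap G)] at h3
  have h4 : ‖(N : ℂ) * ((∫ t, F t) - ∫ t, G t)‖ ≤ ε / 3 * N := by
    rw [norm_mul, Complex.norm_natCast, mul_comm]
    gcongr
  have e : ∑ j ∈ Finset.range N, F (θ + j • (ω : UnitAddCircle)) - N * ∫ t, F t =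
      (∑ j ∈ Finset.range N, F (θ + j • (ω : UnitAddCircle)) -
        ∑ j ∈ Finset.range N, G (θ + j • (ω : UnitAddCircle))) +
      (∑ j ∈ Finset.range N, G (θ + j • (ω : UnitAddCircle)) - N * ∫ t, G t) -
      (N : ℂ) * ((∫ t, F t) - ∫ t, G t) := by ring
  rw [e]
  refine (norm_sub_le _ _).trans ((add_le_add_left (norm_add_le _ _) _).trans ?_)
  linarith

lemma sum_orbit_le_of_continuous {ω : ℝ} (hω : Irrational ω) {ψ : UnitAddCircle → ℝ}
    (hψ : Continuous ψ) {ε : ℝ} (hε : 0 < ε) :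
    ∃ N₀ : ℕ, ∀ N ≥ N₀, ∀ θ : UnitAddCircle,
      ∑ j ∈ Finset.range N, ψ (θ + j • (ω : UnitAddCircle)) ≤ N * ((∫ t, ψ t) + ε) := by
  obtain ⟨N₀, h⟩ := hasUniformAverage hω ⟨fun t => (ψ t : ℂ), by fun_prop⟩ ε hε
  refine ⟨N₀, fun N hN θ => ?_⟩
  have h1 := h N hN θ
  simp only [ContinuousMap.coe_mk] at h1
  rw [integral_complex_ofReal] at h1
  have h2 := (Complex.re_le_norm _).trans h1
  rw [show (∑ j ∈ Finset.range N, (ψ (θ + j • (ω : UnitAddCircle)) : ℂ) - N * ((∫ t, ψ t : ℝ) : ℂ))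
    = ((∑ j ∈ Finset.range N, ψ (θ + j • (ω : UnitAddCircle)) - N * ∫ t, ψ t : ℝ) : ℂ) by
      push_cast; rfl, Complex.ofReal_re] at h2
  linarith

/-! ### Continuous majorants -/

lemma aestronglyMeasurable_of_continuousAt_off_finite {D : Set UnitAddCircle} (hD : D.Finite)
    {φ : UnitAddCircle → ℝ} (hφ : ∀ t ∉ D, ContinuousAt φ t) :
    AEStronglyMeasurable φ (volume : Measure UnitAddCircle) := by
  have hc : ContinuousOn φ Dᶜ := fun t ht => (hφ t ht).continuousWithinAt
  have h1 := hc.aestronglyMeasurable (μ := (volume : Measure UnitAddCircle))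
    hD.measurableSet.compl
  have h2 : (volume : Measure UnitAddCircle).restrict Dᶜ = volume := by
    apply Measure.restrict_eq_self_of_ae_mem
    exact measure_eq_zero_iff_ae_notMem.1 (hD.measure_zero _)
  rwa [h2] at h1

lemma integrable_of_continuousAt_off_finite {D : Set UnitAddCircle} (hD : D.Finite)
    {φ : UnitAddCircle → ℝ} (hφ : ∀ t ∉ D, ContinuousAt φ t) {M : ℝ} (h0 : ∀ t, 0 ≤ φ t)
    (hM : ∀ t, φ t ≤ M) : Integrable φ :=
  (integrable_const M).mono' (aestronglyMeasurable_of_continuousAt_off_finite hD hφ)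
    (Eventually.of_forall fun t => by rw [Real.norm_eq_abs, abs_of_nonneg (h0 t)]; exact hM t)

/-- A bounded function with finitely many discontinuities has a continuous majorant whose integral
is arbitrarily close to its own. -/
lemma exists_continuous_majorant {D : Set UnitAddCircle} (hD : D.Finite)
    {φ : UnitAddCircle → ℝ} (hφ : ∀ t ∉ D, ContinuousAt φ t) {M : ℝ} (h0 : ∀ t, 0 ≤ φ t)
    (hM : ∀ t, φ t ≤ M) {ε : ℝ} (hε : 0 < ε) :
    ∃ ψ : UnitAddCircle → ℝ, Continuous ψ ∧ (∀ t, φ t ≤ ψ t) ∧ ∫ t, ψ t ≤ (∫ t, φ t) + ε := by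
  -- A point is added because `Metric.infDist` to the empty set is 0, which would make the cutoffs χ
  -- identically 1.
  obtain ⟨D', hD', hDD', hne⟩ : ∃ D' : Set UnitAddCircle, D'.Finite ∧ D ⊆ D' ∧ D'.Nonempty :=
    ⟨insert 0 D, hD.insert 0, Set.subset_insert _ _, Set.insert_nonempty _ _⟩
  let χ : ℕ → UnitAddCircle → ℝ := fun n t => max 0 (1 - n * Metric.infDist t D')
  have hχ0 : ∀ n t, 0 ≤ χ n t := fun n t => le_max_left _ _
  have hχ1 : ∀ n t, χ n t ≤ 1 := fun n t => max_le zero_le_one (by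
    have : 0 ≤ (n : ℝ) * Metric.infDist t D' := mul_nonneg (Nat.cast_nonneg _) Metric.infDist_nonneg
    linarith)
  have hχc : ∀ n, Continuous (χ n) := fun n => by
    have := Metric.continuous_infDist_pt D'
    fun_prop
  let ψ : ℕ → UnitAddCircle → ℝ := fun n t => φ t + (M - φ t) * χ n t
  have hψc : ∀ n, Continuous (ψ n) := by
    intro n
    rw [continuous_iff_continuousAt]
    intro t
    by_cases ht : t ∈ D'
    · have hχt : χ n t = 1 := by simp [χ, Metric.infDist_zero_of_mem ht]
      have hψt : ψ n t = M := by simp [ψ, hχt]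
      -- In this form the possibly discontinuous factor M - φ is bounded and multiplies 1 - χ, which
      -- vanishes at t.
      have hψ' : ψ n = fun s => M - (M - φ s) * (1 - χ n s) := by
        ext s; simp only [ψ]; ring
      unfold ContinuousAt
      rw [hψt, hψ']
      have hlim : Tendsto (fun s => M * (1 - χ n s)) (𝓝 t) (𝓝 0) := by
        have : Tendsto (fun s => M * (1 - χ n s)) (𝓝 t) (𝓝 (M * (1 - χ n t))) :=
          (continuous_const.mul (continuous_const.sub (hχc n))).tendsto t
        simpa [hχt] using this
      have hz : Tendsto (fun s => (M - φ s) * (1 - χ n s)) (𝓝 t) (𝓝 0) := by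
        refine squeeze_zero (fun s => mul_nonneg (by linarith [hM s]) (by linarith [hχ1 n s]))
          (fun s => ?_) hlim
        exact mul_le_mul_of_nonneg_right (by linarith [h0 s]) (by linarith [hχ1 n s])
      simpa using hz.const_sub M
    · have h1 := hφ t fun h => ht (hDD' h)
      exact h1.add ((continuousAt_const.sub h1).mul (hχc n).continuousAt)
  have hφψ : ∀ n t, φ t ≤ ψ n t := fun n t => by
    have := mul_nonneg (by linarith [hM t] : 0 ≤ M - φ t) (hχ0 n t)
    simp only [ψ]; linarith
  have hψM : ∀ n t, ψ n t ≤ M := fun n t => by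
    have := mul_le_mul_of_nonneg_left (hχ1 n t) (by linarith [hM t] : 0 ≤ M - φ t)
    simp only [ψ]; linarith
  have hlim : Tendsto (fun n => ∫ t, ψ n t) atTop (𝓝 (∫ t, φ t)) := by
    refine tendsto_integral_of_dominated_convergence (fun _ => M)
      (fun n => (hψc n).aestronglyMeasurable) (integrable_const M)
      (fun n => Eventually.of_forall fun t => ?_) ?_
    · rw [Real.norm_eq_abs, abs_of_nonneg ((h0 t).trans (hφψ n t))]
      exact hψM n t
    · have hae : ∀ᵐ t : UnitAddCircle, t ∉ D' :=
        measure_eq_zero_iff_ae_notMem.1 (hD'.measure_zero _)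
      filter_upwards [hae] with t ht
      have hpos : 0 < Metric.infDist t D' :=
        (hD'.isClosed.notMem_iff_infDist_pos hne).1 ht
      obtain ⟨n₀, hn₀⟩ := exists_nat_gt (1 / Metric.infDist t D')
      refine tendsto_const_nhds.congr' ?_
      filter_upwards [eventually_ge_atTop n₀] with n hn
      have h1 : 1 < n₀ * Metric.infDist t D' := (div_lt_iff₀ hpos).1 hn₀
      have h2 : (n₀ : ℝ) * Metric.infDist t D' ≤ n * Metric.infDist t D' := by gcongr
      have : χ n t = 0 := max_eq_left (by linarith)
      simp [ψ, this]
  obtain ⟨n, hn⟩ := (hlim.eventually (gt_mem_nhds (by linarith : ∫ t, φ t < (∫ t, φ t) + ε))).exists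
  exact ⟨ψ n, hψc n, hφψ n, hn.le⟩

/-! ### Upper bounds for the cocycle, uniform in the phase -/

lemma cocycle_add_nsmul (ω : ℝ) (g : UnitAddCircle → ℂ) (z : ℂ) (k i : ℕ) (θ : UnitAddCircle) :
    cocycle ω g z k (θ + i • (ω : UnitAddCircle)) =
      stepProd (fun j => z - g (θ + (i + j) • (ω : UnitAddCircle))) k := by
  rw [cocycle_eq_stepProd]
  simp only [add_smul, add_assoc]

lemma norm_stepMatrix_sub_apply_le {z : ℂ} {g : UnitAddCircle → ℂ} {R M : ℝ} (hz : ‖z‖ ≤ R)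
    (hg : ∀ t, ‖g t‖ ≤ M) (t : UnitAddCircle) : ‖stepMatrix (z - g t)‖ ≤ R + M + 1 := by
  refine (norm_stepMatrix_le _).trans ?_
  linarith [norm_sub_le z (g t), hg t]

lemma log_norm_cocycle_nonneg (ω : ℝ) (g : UnitAddCircle → ℂ) (z : ℂ) (k : ℕ)
    (θ : UnitAddCircle) : 0 ≤ Real.log ‖cocycle ω g z k θ‖ := by
  rw [cocycle_eq_stepProd]
  exact log_norm_stepProd_nonneg _ _

lemma continuousAt_cocycle {ω : ℝ} {g : UnitAddCircle → ℂ} (z : ℂ) (k : ℕ) {t : UnitAddCircle}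
    (h : ∀ j < k, ContinuousAt g (t + j • (ω : UnitAddCircle))) :
    ContinuousAt (cocycle ω g z k) t := by
  induction k with
  | zero => exact continuousAt_const
  | succ k ih =>
    have h1 := ih fun j hj => h j (by omega)
    have h2 : ContinuousAt (fun s => g (s + k • (ω : UnitAddCircle))) t :=
      ContinuousAt.comp (f := fun s => s + k • (ω : UnitAddCircle)) (h k (by omega)) (by fun_prop)
    have h3 : Continuous fun w : ℂ => stepMatrix w := by
      refine continuous_matrix fun i j => ?_
      fin_cases i <;> fin_cases j <;> simp [stepMatrix] <;> fun_prop
    have h4 : ContinuousAt (fun s => stepMatrix (z - g (s + k • (ω : UnitAddCircle)))) t :=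
      h3.continuousAt.comp (continuousAt_const.sub h2)
    exact h4.mul h1

lemma exists_finite_continuousAt_log_norm_cocycle (ω : ℝ) {f : UnitAddCircle → ℝ}
    (hf : (discontinuities f).Finite) (z : ℂ) (k : ℕ) :
    ∃ D : Set UnitAddCircle, D.Finite ∧ ∀ t ∉ D,
      ContinuousAt (fun θ => Real.log ‖cocycle ω (fun s => (f s : ℂ)) z k θ‖) t := by
  refine ⟨⋃ j ∈ Finset.range k, (fun t => t + j • (ω : UnitAddCircle)) ⁻¹' discontinuities f,
    ?_, fun t ht => ?_⟩
  · refine Set.Finite.biUnion (Finset.finite_toSet _) fun j _ => hf.preimage ?_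
    exact (add_left_injective _).injOn
  · have hc : ContinuousAt (cocycle ω (fun s => (f s : ℂ)) z k) t := by
      refine continuousAt_cocycle z k fun j hj => ?_
      have : ContinuousAt f (t + j • (ω : UnitAddCircle)) := by
        by_contra hcon
        exact ht (Set.mem_biUnion (Finset.mem_coe.2 (Finset.mem_range.2 hj)) hcon)
      exact Complex.continuous_ofReal.continuousAt.comp this
    refine hc.norm.log ?_
    rw [cocycle_eq_stepProd]
    linarith [one_le_norm_stepProd (fun j => z - (f (t + j • (ω : UnitAddCircle)) : ℂ)) k]

lemma IsPiecewiseLipschitz.exists_bound {γ : ℝ} {f : UnitAddCircle → ℝ}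
    (hf : IsPiecewiseLipschitz γ f) : ∃ M : ℝ, 0 ≤ M ∧ ∀ t, ‖(f t : ℂ)‖ ≤ M := by
  obtain ⟨M, hM⟩ := hf.bounded
  have h : ∀ t, ‖(f t : ℂ)‖ ≤ M := fun t => by
    rw [Complex.norm_real]
    exact hM ⟨t, rfl⟩
  exact ⟨M, (norm_nonneg _).trans (h 0), h⟩

lemma log_norm_cocycle_le {ω : ℝ} {g : UnitAddCircle → ℂ} {z : ℂ} {R M : ℝ} (hM : 0 ≤ M)
    (hz : ‖z‖ ≤ R) (hg : ∀ t, ‖g t‖ ≤ M) (k : ℕ) (θ : UnitAddCircle) :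
    Real.log ‖cocycle ω g z k θ‖ ≤ k * Real.log (R + M + 1) := by
  rw [cocycle_eq_stepProd]
  exact log_norm_stepProd_le (by linarith [norm_nonneg z])
    (fun i => norm_stepMatrix_sub_apply_le hz hg _) k

lemma integrable_log_norm_cocycle (ω : ℝ) {γ : ℝ} {f : UnitAddCircle → ℝ}
    (hf : IsPiecewiseLipschitz γ f) (z : ℂ) (k : ℕ) :
    Integrable fun θ => Real.log ‖cocycle ω (fun s => (f s : ℂ)) z k θ‖ := by
  obtain ⟨M, hM, hfM⟩ := hf.exists_bound
  obtain ⟨D, hD, hc⟩ := exists_finite_continuousAt_log_norm_cocycle ω hf.finite_discontinuities z k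
  exact integrable_of_continuousAt_off_finite hD hc (log_norm_cocycle_nonneg _ _ _ _)
    (log_norm_cocycle_le hM le_rfl hfM k)

lemma lyapunov_mul_le_integral (ω : ℝ) (f : UnitAddCircle → ℝ) (z : ℂ) {k : ℕ} (hk : 0 < k) :
    k * lyapunov ω f z ≤ ∫ θ, Real.log ‖cocycle ω (fun s => (f s : ℂ)) z k θ‖ := by
  have h : lyapunov ω f z ≤
      (∫ θ, Real.log ‖cocycle ω (fun s => (f s : ℂ)) z k θ‖) / k := by
    -- The real infimum needs a lower bound: determinant one makes every logarithm nonnegative.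
    refine csInf_le ⟨0, ?_⟩ ⟨k, hk, rfl⟩
    rintro _ ⟨j, -, rfl⟩
    exact div_nonneg (integral_nonneg fun θ => log_norm_cocycle_nonneg _ _ _ _ _) (by positivity)
  rw [le_div_iff₀ (by positivity)] at h
  linarith

lemma lyapunov_nonneg (ω : ℝ) (f : UnitAddCircle → ℝ) (z : ℂ) : 0 ≤ lyapunov ω f z := by
  refine Real.sInf_nonneg ?_
  rintro _ ⟨j, -, rfl⟩
  exact div_nonneg (integral_nonneg fun θ => log_norm_cocycle_nonneg _ _ _ _ _) (by positivity)

/-- The upper bound of the subadditive ergodic theorem is uniform in the phase. -/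
lemma exists_log_norm_cocycle_le {ω : ℝ} (hω : Irrational ω) {γ : ℝ} {f : UnitAddCircle → ℝ}
    (hf : IsPiecewiseLipschitz γ f) (E : ℂ) {Λ : ℝ} (hΛ : lyapunov ω f E < Λ) :
    ∃ m : ℕ, 0 < m ∧ ∀ θ, Real.log ‖cocycle ω (fun s => (f s : ℂ)) E m θ‖ ≤ m * Λ := by
  obtain ⟨M, hM, hfM⟩ := hf.exists_bound
  obtain ⟨Λ₁, h1, h2⟩ := exists_between hΛ
  obtain ⟨_, ⟨k, hk, rfl⟩, hkΛ⟩ := exists_lt_of_csInf_lt (Set.nonempty_Ici.image _) h1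
  replace hk : 0 < k := hk
  have hk0 : (0 : ℝ) < k := by exact_mod_cast hk
  simp only at hkΛ
  rw [div_lt_iff₀ hk0] at hkΛ
  obtain ⟨D, hD, hc⟩ := exists_finite_continuousAt_log_norm_cocycle ω hf.finite_discontinuities E k
  -- One η each for the majorant, the equidistribution error and the boundary term of the averaged
  -- splitting.
  set η := (Λ - Λ₁) / 3 with hη
  have hη0 : 0 < η := by rw [hη]; linarith
  obtain ⟨ψ, hψc, hψ, hψi⟩ := exists_continuous_majorant hD hc (log_norm_cocycle_nonneg _ _ _ _)
    (log_norm_cocycle_le hM le_rfl hfM k) (mul_pos hk0 hη0)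
  obtain ⟨N₀, hN₀⟩ := sum_orbit_le_of_continuous hω hψc (mul_pos hk0 hη0)
  set B := ‖E‖ + M + 1 with hB
  have hB1 : 1 ≤ B := by rw [hB]; linarith [norm_nonneg E]
  obtain ⟨N₁, hN₁⟩ := exists_nat_ge (3 * k * Real.log B / η)
  have hN₁' := (div_le_iff₀ hη0).1 hN₁
  let N := max N₀ N₁ + k
  have hN₁N : (N₁ : ℝ) ≤ N := by exact_mod_cast (le_max_right _ _).trans (Nat.le_add_right _ _)
  refine ⟨N, by omega, fun θ => ?_⟩
  rw [cocycle_eq_stepProd]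
  have hmain := mul_log_norm_stepProd_le (m := k) (N := N) (by omega) hB1
    (a := fun j => E - (f (θ + j • (ω : UnitAddCircle)) : ℂ))
    (fun i => norm_stepMatrix_sub_apply_le le_rfl hfM _)
  simp only [← cocycle_add_nsmul ω (fun s => (f s : ℂ))] at hmain
  have hsum := (Finset.sum_le_sum fun i (_ : i ∈ Finset.range N) =>
    hψ (θ + i • (ω : UnitAddCircle))).trans (hN₀ N (by omega) θ)
  have h3 : (N : ℝ) * ((∫ t, ψ t) + k * η) ≤ N * (k * (Λ₁ + 2 * η)) := by
    gcongr
    linarith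
  have h4 : (N₁ : ℝ) * η ≤ N * η := by gcongr
  have h5 : (k : ℝ) * (3 * k * Real.log B) ≤ k * (N * η) := by
    exact mul_le_mul_of_nonneg_left (hN₁'.trans h4) hk0.le
  refine le_of_mul_le_mul_left (a := (k : ℝ)) ?_ hk0
  calc _ ≤ N * (k * (Λ₁ + 2 * η)) + k * (N * η) := by linarith
    _ = k * (N * Λ) := by rw [hη]; ring

lemma norm_cocycle_sub_le {ω : ℝ} {g g' : UnitAddCircle → ℂ} {z z' : ℂ} {C Λ η : ℝ} (hΛ : 0 ≤ Λ)
    (hg : ∀ m φ, ‖cocycle ω g z m φ‖ ≤ C * Real.exp (m * Λ))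
    (hg' : ∀ m φ, ‖cocycle ω g' z' m φ‖ ≤ C * Real.exp (m * Λ)) {k : ℕ} {y θ : UnitAddCircle}
    (h : ∀ j < k, ‖z - z'‖ +
      ‖g (y + j • (ω : UnitAddCircle)) - g' (θ + j • (ω : UnitAddCircle))‖ ≤ η) :
    ‖cocycle ω g z k y - cocycle ω g' z' k θ‖ ≤ k * (C ^ 2 * Real.exp (k * Λ) * η) := by
  rw [cocycle_eq_stepProd, cocycle_eq_stepProd ω g']
  refine norm_stepProd_sub_le hΛ k (fun i m => ?_) (fun m => ?_) fun j hj => ?_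
  · rw [← cocycle_add_nsmul]
    exact hg _ _
  · rw [← cocycle_eq_stepProd ω g']
    exact hg' _ _
  · refine le_trans ?_ (h j hj)
    rw [sub_sub_sub_comm]
    exact norm_sub_le _ _

lemma norm_cocycle_le_exp_log {ω : ℝ} {g : UnitAddCircle → ℂ} {z : ℂ} {B : ℝ} (hB : 0 < B)
    (hg : ∀ t, ‖stepMatrix (z - g t)‖ ≤ B) (m : ℕ) (φ : UnitAddCircle) :
    ‖cocycle ω g z m φ‖ ≤ 1 * Real.exp (m * Real.log B) := by
  rw [one_mul, ← Real.log_pow, Real.exp_log (by positivity), cocycle_eq_stepProd]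
  exact norm_stepProd_le_pow hB.le (fun j => hg _) m

/-- A single block length m serves all phases. The comparison with f is made at the same phase, so
no continuity of f enters, and the gap e^{mΛ} - e^{mΛ'} leaves room for a perturbation of size r;
blocks are then iterated. -/
lemma exists_norm_cocycle_le {ω : ℝ} (hω : Irrational ω) {γ : ℝ} {f : UnitAddCircle → ℝ}
    (hf : IsPiecewiseLipschitz γ f) (E : ℂ) {Λ : ℝ} (hΛ : lyapunov ω f E < Λ) :
    ∃ C r : ℝ, 0 < r ∧ ∀ (z : ℂ) (g : UnitAddCircle → ℂ), ‖z - E‖ ≤ r →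
      (∀ t, ‖g t - f t‖ ≤ r) → ∀ k θ, ‖cocycle ω g z k θ‖ ≤ C * Real.exp (k * Λ) := by
  obtain ⟨M, hM, hfM⟩ := hf.exists_bound
  obtain ⟨Λ', h1, h2⟩ := exists_between hΛ
  have hΛ0 : 0 ≤ Λ := (lyapunov_nonneg ω f E).trans hΛ.le
  obtain ⟨m, hm, hmΛ⟩ := exists_log_norm_cocycle_le hω hf E h1
  have hm0 : (0 : ℝ) < m := by exact_mod_cast hm
  set B := (‖E‖ + 1) + (M + 1) + 1 with hB
  have hB1 : 1 ≤ B := by rw [hB]; linarith [norm_nonneg E]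
  have hB0 : 0 < B := by linarith
  set X := Real.exp (m * Λ) - Real.exp (m * Λ') with hX
  have hX0 : 0 < X := sub_pos.2 (Real.exp_lt_exp.2 (by gcongr))
  refine ⟨B ^ m, min 1 (X / (2 * m * B ^ m)), by positivity, fun z g hz hg k θ => ?_⟩
  set r := min 1 (X / (2 * m * B ^ m)) with hr
  have hr1 : r ≤ 1 := min_le_left _ _
  have hr0 : 0 ≤ r := (norm_nonneg _).trans hz
  have hrX : 2 * m * B ^ m * r ≤ X := by
    have := (le_div_iff₀ (by positivity)).1 (min_le_right 1 (X / (2 * m * B ^ m)))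
    linarith
  have hzn : ‖z‖ ≤ ‖E‖ + 1 := by
    linarith [norm_le_norm_add_norm_sub' z E]
  have hgn : ∀ t, ‖g t‖ ≤ M + 1 := fun t => by
    linarith [norm_le_norm_add_norm_sub' (g t) (f t : ℂ), hg t, hfM t]
  have hblock : ∀ φ, ‖cocycle ω g z m φ‖ ≤ Real.exp (m * Λ) := by
    intro φ
    have hf1 : ‖cocycle ω (fun s => (f s : ℂ)) E m φ‖ ≤ Real.exp (m * Λ') := by
      rw [← Real.log_le_iff_le_exp]
      · exact hmΛ φ
      · rw [cocycle_eq_stepProd]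
        exact zero_lt_one.trans_le (one_le_norm_stepProd _ _)
    have hd := norm_cocycle_sub_le (ω := ω) (g := g) (g' := fun s => (f s : ℂ)) (z := z) (z' := E)
      (C := 1) (η := 2 * r) (k := m) (y := φ) (θ := φ) (Real.log_nonneg hB1)
      (norm_cocycle_le_exp_log hB0 (norm_stepMatrix_sub_apply_le hzn hgn))
      (norm_cocycle_le_exp_log hB0 (norm_stepMatrix_sub_apply_le (by linarith)
        fun t => by linarith [hfM t]))
      (fun j _ => by linarith [hg (φ + j • (ω : UnitAddCircle))])
    rw [one_pow, one_mul, ← Real.log_pow, Real.exp_log (by positivity)] at hd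
    have h3 := norm_le_norm_add_norm_sub' (cocycle ω g z m φ)
      (cocycle ω (fun s => (f s : ℂ)) E m φ)
    calc _ ≤ Real.exp (m * Λ') + m * (B ^ m * (2 * r)) := by linarith
      _ = Real.exp (m * Λ') + 2 * m * B ^ m * r := by ring
      _ ≤ Real.exp (m * Λ) := by linarith
  rw [cocycle_eq_stepProd]
  refine norm_stepProd_le_of_block hm hB1 hΛ0 k _
    (fun i => norm_stepMatrix_sub_apply_le hzn hgn _) fun i => ?_
  rw [← cocycle_add_nsmul]
  exact hblock _

/-- Uniform upper bounds for the cocycles near a compact set on which the Lyapunov exponent is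
positive and continuous. -/
lemma exists_norm_cocycle_le_of_isCompact {ω : ℝ} (hω : Irrational ω) {γ : ℝ}
    {f : UnitAddCircle → ℝ} (hf : IsPiecewiseLipschitz γ f) {U : Set ℂ} (hU : IsCompact U)
    (hpos : ∀ E ∈ U, 0 < lyapunov ω f E) (hcont : ContinuousOn (lyapunov ω f) U)
    {ε : ℝ} (hε : 0 < ε) :
    ∃ C r : ℝ, 0 < r ∧ ∀ E ∈ U, ∀ (z : ℂ) (g : UnitAddCircle → ℂ), ‖z - E‖ ≤ r →
      (∀ t, ‖g t - f t‖ ≤ r) → ∀ k θ,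
        ‖cocycle ω g z k θ‖ ≤ C * Real.exp (k * ((1 + ε) * lyapunov ω f E)) := by
  refine hU.induction_on (p := fun s => ∃ C r : ℝ, 0 < r ∧ ∀ E ∈ s, ∀ (z : ℂ)
      (g : UnitAddCircle → ℂ), ‖z - E‖ ≤ r → (∀ t, ‖g t - f t‖ ≤ r) → ∀ k θ,
        ‖cocycle ω g z k θ‖ ≤ C * Real.exp (k * ((1 + ε) * lyapunov ω f E))) ?_ ?_ ?_ ?_
  · exact ⟨1, 1, one_pos, by simp⟩
  · rintro s t hst ⟨C, r, hr, h⟩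
    exact ⟨C, r, hr, fun E hE => h E (hst hE)⟩
  · rintro s t ⟨C, r, hr, h⟩ ⟨C', r', hr', h'⟩
    refine ⟨max C C', min r r', lt_min hr hr', fun E hE z g hz hg k θ => ?_⟩
    rcases hE with hE | hE
    · refine (h E hE z g (hz.trans (min_le_left _ _))
        (fun t => (hg t).trans (min_le_left _ _)) k θ).trans ?_
      gcongr
      exact le_max_left _ _
    · refine (h' E hE z g (hz.trans (min_le_right _ _))
        (fun t => (hg t).trans (min_le_right _ _)) k θ).trans ?_
      gcongr
      exact le_max_right _ _
  · intro E₀ hE₀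
    have hL := hpos E₀ hE₀
    -- Half of ε is spent at the centre E₀; continuity of the exponent absorbs the other half at
    -- nearby E.
    obtain ⟨C, r, hr, h⟩ := exists_norm_cocycle_le hω hf E₀
      (Λ := (1 + ε / 2) * lyapunov ω f E₀) (by nlinarith)
    have hC : 0 ≤ C := by
      have := (norm_nonneg _).trans (h E₀ (fun s => (f s : ℂ)) (by simpa using hr.le)
        (by simpa using hr.le) 0 0)
      simpa using this
    have ev1 : ∀ᶠ E in 𝓝[U] E₀, (1 + ε / 2) * lyapunov ω f E₀ < (1 + ε) * lyapunov ω f E := by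
      have : Tendsto (fun E => (1 + ε) * lyapunov ω f E) (𝓝[U] E₀)
          (𝓝 ((1 + ε) * lyapunov ω f E₀)) := (hcont E₀ hE₀).const_mul _
      exact this.eventually (lt_mem_nhds (by nlinarith))
    have ev2 : ∀ᶠ E in 𝓝[U] E₀, dist E E₀ < r / 2 :=
      mem_nhdsWithin_of_mem_nhds (Metric.ball_mem_nhds _ (by positivity))
    refine ⟨_, ev1.and ev2, C, r / 2, by positivity, fun E hE z g hz hg k θ => ?_⟩
    obtain ⟨hE1, hE2⟩ := hE
    rw [dist_eq_norm] at hE2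
    refine (h z g ?_ (fun t => (hg t).trans (by linarith)) k θ).trans ?_
    · have : z - E₀ = (z - E) + (E - E₀) := by ring
      rw [this]
      linarith [norm_add_le (z - E) (E - E₀)]
    · gcongr

/-! ### A good phase -/

lemma measureReal_biUnion_closedBall_le (s : Finset ℕ) (J : Finset UnitAddCircle)
    (c : ℕ → UnitAddCircle → UnitAddCircle) {r : ℝ} (hr : 0 ≤ r) :
    (volume : Measure UnitAddCircle).real (⋃ j ∈ s, ⋃ p ∈ J, Metric.closedBall (c j p) r) ≤
      s.card * (J.card * (2 * r)) := by
  have hball : ∀ x : UnitAddCircle,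
      (volume : Measure UnitAddCircle).real (Metric.closedBall x r) ≤ 2 * r := by
    intro x
    rw [measureReal_def, AddCircle.volume_closedBall, ENNReal.toReal_ofReal (by positivity)]
    exact min_le_right _ _
  calc _ ≤ ∑ j ∈ s, (volume : Measure UnitAddCircle).real (⋃ p ∈ J, Metric.closedBall (c j p) r) :=
        measureReal_biUnion_finset_le _ _
    _ ≤ ∑ _j ∈ s, (J.card * (2 * r)) := by
        refine Finset.sum_le_sum fun j _ => (measureReal_biUnion_finset_le _ _).trans ?_
        refine (Finset.sum_le_sum fun p _ => hball _).trans ?_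
        simp
    _ = _ := by simp

/-- There is a phase whose orbit segment stays away from the discontinuities and along which the
cocycle is nearly as large as its mean. -/
lemma exists_good_phase (ω : ℝ) {γ : ℝ} {f : UnitAddCircle → ℝ} (hf : IsPiecewiseLipschitz γ f)
    {M R : ℝ} (hM : 0 ≤ M) (hfM : ∀ t, ‖(f t : ℂ)‖ ≤ M) {E : ℂ} (hE : ‖E‖ ≤ R)
    {ε δ : ℝ} (hε : ε ≤ 1) (hδ : 0 ≤ δ) {k : ℕ} (hk : 0 < k)
    (hsmall : k * ((discontinuities f).ncard * (2 * (2 * δ))) * Real.log (R + M + 1) <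
      ε * lyapunov ω f E) :
    ∃ θ₀ : UnitAddCircle,
      (∀ j < k, ∀ p ∈ discontinuities f, 2 * δ < dist (θ₀ + j • (ω : UnitAddCircle)) p) ∧
      k * ((1 - ε) * lyapunov ω f E) ≤
        Real.log ‖cocycle ω (fun s => (f s : ℂ)) E k θ₀‖ := by
  by_contra! hcon
  have hk0 : (0 : ℝ) < k := by exact_mod_cast hk
  have hL := lyapunov_nonneg ω f E
  have hlB : 0 ≤ Real.log (R + M + 1) := Real.log_nonneg (by linarith [norm_nonneg E])
  set J := hf.finite_discontinuities.toFinset with hJ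
  have hcard : (discontinuities f).ncard = J.card :=
    Set.ncard_eq_toFinset_card _ hf.finite_discontinuities
  set S : Set UnitAddCircle := ⋃ j ∈ Finset.range k, ⋃ p ∈ J,
    Metric.closedBall (p - j • (ω : UnitAddCircle)) (2 * δ) with hS
  have hSm : MeasurableSet S := by
    refine Finset.measurableSet_biUnion _ fun j _ => Finset.measurableSet_biUnion _ fun p _ => ?_
    exact Metric.isClosed_closedBall.measurableSet
  have hSv := measureReal_biUnion_closedBall_le (Finset.range k) J
    (fun j p => p - j • (ω : UnitAddCircle)) (r := 2 * δ) (by positivity)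
  rw [← hS, Finset.card_range, ← hcard] at hSv
  -- If no good phase exists, the lower bound fails off S; integrating, with the trivial bound on
  -- the small set S, puts the mean below kL.
  have hpt : ∀ θ, Real.log ‖cocycle ω (fun s => (f s : ℂ)) E k θ‖ ≤
      k * ((1 - ε) * lyapunov ω f E) + S.indicator (fun _ => k * Real.log (R + M + 1)) θ := by
    intro θ
    by_cases hθ : θ ∈ S
    · rw [Set.indicator_of_mem hθ]
      have h1 := log_norm_cocycle_le (ω := ω) hM hE hfM k θ
      have h2 : 0 ≤ k * ((1 - ε) * lyapunov ω f E) :=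
        mul_nonneg hk0.le (mul_nonneg (by linarith) hL)
      linarith
    · rw [Set.indicator_of_notMem hθ, add_zero]
      refine (hcon θ fun j hj p hp => ?_).le
      by_contra! hd
      refine hθ ?_
      simp only [hS, Set.mem_iUnion, Finset.mem_range, exists_prop]
      refine ⟨j, hj, p, by simpa [hJ] using hp, ?_⟩
      rw [Metric.mem_closedBall, dist_eq_norm]
      rw [dist_eq_norm] at hd
      rwa [sub_sub_eq_add_sub]
  have hint := integral_mono (integrable_log_norm_cocycle ω hf E k)
    ((integrable_const _).add ((integrable_const _).indicator hSm)) hpt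
  simp only [Pi.add_apply] at hint
  rw [integral_add (integrable_const _) ((integrable_const _).indicator hSm),
    integral_indicator_const _ hSm] at hint
  simp only [integral_const, probReal_univ, smul_eq_mul, one_mul] at hint
  have hlow := lyapunov_mul_le_integral ω f E hk
  have h3 : (volume : Measure UnitAddCircle).real S * (k * Real.log (R + M + 1)) ≤
      k * ((discontinuities f).ncard * (2 * (2 * δ))) * (k * Real.log (R + M + 1)) := by
    gcongr
  have h4 := mul_lt_mul_of_pos_left hsmall hk0
  nlinarith

/-! ### Choice of the threshold and conclusion -/

/-- Boundedness matters: a real supremum over an unbounded family is 0 by convention. -/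
lemma norm_sub_le_supNorm {f : UnitAddCircle → ℝ} {g : UnitAddCircle → ℂ} {M : ℝ}
    (hfM : ∀ t, ‖(f t : ℂ)‖ ≤ M) (hg : BddAbove (Set.range fun t => ‖g t‖)) (t : UnitAddCircle) :
    ‖g t - f t‖ ≤ supNorm fun t => g t - (f t : ℂ) := by
  obtain ⟨N, hN⟩ := hg
  refine le_ciSup (f := fun t => ‖g t - (f t : ℂ)‖) ⟨N + M, ?_⟩ t
  rintro _ ⟨s, rfl⟩
  exact (norm_sub_le _ _).trans (add_le_add (hN ⟨s, rfl⟩) (hfM s))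

lemma tendsto_natCast_mul_exp_neg {c : ℝ} (hc : 0 < c) :
    Tendsto (fun k : ℕ => (k : ℝ) * Real.exp (-(c * k))) atTop (𝓝 0) := by
  have h := tendsto_self_mul_const_pow_of_lt_one (r := Real.exp (-c)) (Real.exp_pos _).le
    (Real.exp_lt_one_iff.2 (by linarith))
  refine h.congr fun k => ?_
  rw [← Real.exp_nat_mul]
  ring_nf

lemma tendsto_exp_neg_mul_natCast {c : ℝ} (hc : 0 < c) :
    Tendsto (fun k : ℕ => Real.exp (-(c * k))) atTop (𝓝 0) :=
  Real.tendsto_exp_neg_atTop_nhds_zero.comp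
    (tendsto_natCast_atTop_atTop.const_mul_atTop hc)

/-- Relative to e^{k(1-ε)L} both terms on the left decay at rate at least τ - 2ε ≥ τ/2 times L.
Replacing L by its lower bound L₀ makes the condition on k independent of the energy. -/
lemma exp_add_error_le {k τ ε L₀ L C G : ℝ} (hk : 0 ≤ k) (hLL : L₀ ≤ L) (hL₀ : 0 ≤ L₀)
    (hε : 0 ≤ ε) (hετ : 4 * ε ≤ τ) (hG : 0 ≤ G)
    (h : C ^ 2 * G * (k * Real.exp (-(τ / 2 * L₀ * k))) + Real.exp (-(τ / 2 * L₀ * k)) ≤ 1) :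
    Real.exp (k * (1 - τ) * L) +
      k * (C ^ 2 * Real.exp (k * ((1 + ε) * L)) * (G * Real.exp (-(τ * k * L)))) ≤
        Real.exp (k * ((1 - ε) * L)) := by
  set X := Real.exp (k * ((1 - ε) * L)) with hX
  set T := Real.exp (-(τ / 2 * L₀ * k)) with hT
  have hkey : ∀ c : ℝ, τ / 2 ≤ c → -(c * (k * L)) ≤ -(τ / 2 * L₀ * k) := by
    intro c hc
    have : τ / 2 * (k * L₀) ≤ c * (k * L) :=
      mul_le_mul hc (mul_le_mul_of_nonneg_left hLL hk) (by positivity) (by linarith)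
    linarith
  have hXT1 : Real.exp (k * ((1 + ε) * L)) * Real.exp (-(τ * k * L)) ≤ X * T := by
    rw [hX, hT, ← Real.exp_add, ← Real.exp_add]
    refine Real.exp_le_exp.2 ?_
    linarith [hkey (τ - 2 * ε) (by linarith)]
  have hXT2 : Real.exp (k * (1 - τ) * L) ≤ X * T := by
    rw [hX, hT, ← Real.exp_add]
    refine Real.exp_le_exp.2 ?_
    linarith [hkey (τ - ε) (by linarith)]
  have hX0 : 0 < X := Real.exp_pos _
  calc _ = Real.exp (k * (1 - τ) * L) + k * C ^ 2 * G *
        (Real.exp (k * ((1 + ε) * L)) * Real.exp (-(τ * k * L))) := by ring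
    _ ≤ X * T + k * C ^ 2 * G * (X * T) := by gcongr
    _ = X * (C ^ 2 * G * (k * T) + T) := by ring
    _ ≤ X * 1 := by gcongr
    _ = X := mul_one X

theorem exists_isThreshold_of_isCompact {ω : ℝ} (hω : Irrational ω) {γ : ℝ} (hγ : 0 < γ)
    {f : UnitAddCircle → ℝ} (hf : IsPiecewiseLipschitz γ f) {U : Set ℂ} (hU : IsCompact U)
    (hpos : ∀ E ∈ U, 0 < lyapunov ω f E) (hcont : ContinuousOn (lyapunov ω f) U)
    {τ : ℝ} (hτ : 0 < τ) : ∃ K : ℕ, ∀ E ∈ U, IsThreshold ω γ f τ E K := by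
  rcases U.eq_empty_or_nonempty with rfl | hne
  · exact ⟨0, by simp⟩
  obtain ⟨E₁, hE₁, hmin⟩ := hU.exists_isMinOn hne hcont
  set L₀ := lyapunov ω f E₁ with hL₀
  have hL₀pos : 0 < L₀ := hpos E₁ hE₁
  have hLmin : ∀ E ∈ U, L₀ ≤ lyapunov ω f E := fun E hE => hmin hE
  obtain ⟨R, hR⟩ := hU.isBounded.exists_norm_le
  obtain ⟨M, hM, hfM⟩ := hf.exists_bound
  obtain ⟨H, hH0, hH⟩ := hf.exists_holder hγ
  set ε := min τ 1 / 4 with hε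
  have hε0 : 0 < ε := by positivity
  have hε1 : ε ≤ 1 := by linarith [min_le_right τ 1]
  have hετ : 4 * ε ≤ τ := by linarith [min_le_left τ 1]
  obtain ⟨C, r, hr, hC⟩ := exists_norm_cocycle_le_of_isCompact hω hf hU hpos hcont hε0
  set B := R + M + 1 with hB
  have hlB : 0 ≤ Real.log B := Real.log_nonneg (by linarith [norm_nonneg E₁, hR E₁ hE₁])
  set A := (discontinuities f).ncard * 8 * Real.log B with hA
  -- In units of e^{-τkL}: one for z - E, one for g - f, and H·2^γ for moving the phase by 2/q_n.
  set G := 2 + H * 2 ^ γ with hG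
  have hG0 : 0 ≤ G := by positivity
  have ev1 : ∀ᶠ k : ℕ in atTop, A * (k * Real.exp (-(τ * L₀ / γ * k))) < ε * L₀ := by
    have h := (tendsto_natCast_mul_exp_neg (c := τ * L₀ / γ) (by positivity)).const_mul A
    rw [mul_zero] at h
    exact h.eventually (gt_mem_nhds (by positivity))
  have ev2 : ∀ᶠ k : ℕ in atTop, Real.exp (-(τ * L₀ * k)) < r :=
    (tendsto_exp_neg_mul_natCast (by positivity)).eventually (gt_mem_nhds hr)
  have ev3 : ∀ᶠ k : ℕ in atTop, C ^ 2 * G * (k * Real.exp (-(τ / 2 * L₀ * k))) +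
      Real.exp (-(τ / 2 * L₀ * k)) < 1 := by
    have h := ((tendsto_natCast_mul_exp_neg (c := τ / 2 * L₀) (by positivity)).const_mul
      (C ^ 2 * G)).add (tendsto_exp_neg_mul_natCast (c := τ / 2 * L₀) (by positivity))
    rw [mul_zero, zero_add] at h
    exact h.eventually (gt_mem_nhds one_pos)
  -- Beyond K the bad phases are negligible, the perturbations lie within radius r, and the
  -- telescoping error is absorbed.
  obtain ⟨K, hK⟩ := eventually_atTop.1 (ev1.and (ev2.and ev3))
  refine ⟨K, fun E hE n _ _ k hk hKk hkq θ => ?_⟩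
  obtain ⟨hk1, hk2, hk3⟩ := hK k hKk.le
  set L := lyapunov ω f E with hL
  have hLpos : 0 < L := hpos E hE
  have hLL : L₀ ≤ L := hLmin E hE
  have hk0 : (0 : ℝ) < k := by exact_mod_cast hk
  set q := approxDen ω n with hq
  have hq1 : 1 ≤ q := one_le_approxDen ω n
  have hq0 : 0 < q := by linarith
  have hqlog : τ * k * L < γ * Real.log q := by
    rw [div_mul_eq_mul_div, lt_div_iff₀ (by positivity)] at hkq
    linarith
  have hqinv : 1 / q ≤ Real.exp (-(τ * L₀ / γ * k)) := by
    rw [one_div, ← Real.exp_log (inv_pos.2 hq0), Real.log_inv]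
    gcongr
    rw [div_mul_eq_mul_div, div_le_iff₀ hγ]
    have : τ * L₀ * k ≤ τ * k * L := by
      rw [mul_right_comm]
      gcongr
    linarith
  set e := Real.exp (-(τ * k * L)) with he
  have hδγ : (2 / q) ^ γ ≤ 2 ^ γ * e := by
    rw [Real.div_rpow (by norm_num) hq0.le, div_eq_mul_inv, ← Real.rpow_neg hq0.le,
      Real.rpow_def_of_pos hq0]
    refine mul_le_mul_of_nonneg_left (Real.exp_le_exp.2 ?_) (by positivity)
    linarith
  have her : e ≤ r := by
    refine le_trans ?_ hk2.le
    rw [he, mul_right_comm]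
    gcongr
  obtain ⟨θ₀, hθ₀J, hθ₀L⟩ := exists_good_phase ω hf hM hfM (hR E hE) hε1
    (δ := 2 / q) (by positivity) hk (by
      calc _ = A * (k * (1 / q)) := by rw [hA]; ring
        _ ≤ A * (k * Real.exp (-(τ * L₀ / γ * k))) := by gcongr
        _ < ε * L₀ := hk1
        _ ≤ ε * L := by gcongr)
  obtain ⟨x, hx, hxq, hxd⟩ := exists_orbit_near hω n θ θ₀
  -- Already x ≤ q_n, which suffices because q_{n-1} ≥ 1.
  refine ⟨x, hx, by linarith [one_le_approxDen ω (n - 1)], fun z hz g hgb hg => ?_⟩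
  have hgf : ∀ t, ‖g t - f t‖ ≤ e := fun t => (norm_sub_le_supNorm hfM hgb t).trans hg.le
  set y := θ + x • (ω : UnitAddCircle) with hy
  have hd := norm_cocycle_sub_le (ω := ω) (g := g) (g' := fun s => (f s : ℂ)) (z := z) (z' := E)
    (C := C) (Λ := (1 + ε) * L) (η := G * e) (k := k) (y := y) (θ := θ₀)
    (mul_nonneg (by linarith) hLpos.le)
    (hC E hE z g (hz.le.trans her) fun t => (hgf t).trans her)
    (hC E hE E _ (by simpa using hr.le) (by simpa using hr.le))
    (fun j hj => by
      have h1 := (hH (θ₀ + j • (ω : UnitAddCircle)) (y + j • (ω : UnitAddCircle)) (2 / q)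
        (by rw [dist_add_right]; exact hxd) (hθ₀J j hj)).trans
        (mul_le_mul_of_nonneg_left hδγ hH0)
      rw [abs_sub_comm, ← Real.norm_eq_abs, ← Complex.norm_real, Complex.ofReal_sub] at h1
      have h2 := norm_sub_le_norm_sub_add_norm_sub (g (y + j • (ω : UnitAddCircle)))
        (f (y + j • (ω : UnitAddCircle)) : ℂ) (f (θ₀ + j • (ω : UnitAddCircle)) : ℂ)
      have h3 := hgf (y + j • (ω : UnitAddCircle))
      have h4 : G * e = e + e + H * (2 ^ γ * e) := by rw [hG]; ring
      rw [h4]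
      linarith)
  have hXle : Real.exp (k * ((1 - ε) * L)) ≤ ‖cocycle ω (fun s => (f s : ℂ)) E k θ₀‖ := by
    rw [← Real.le_log_iff_exp_le]
    · exact hθ₀L
    · rw [cocycle_eq_stepProd]
      exact zero_lt_one.trans_le (one_le_norm_stepProd _ _)
  have h6 := exp_add_error_le hk0.le hLL hL₀pos.le hε0.le hετ hG0 hk3.le
  have h7 := norm_le_norm_add_norm_sub (cocycle ω g z k y)
    (cocycle ω (fun s => (f s : ℂ)) E k θ₀)
  linarith

end RoughSchrodinger

end

theorem mainTheorem6 (ω : ℝ) (hω : Irrational ω) (γ : ℝ) (hγ : 0 < γ)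
    (f : UnitAddCircle → ℝ) (hf : RoughSchrodinger.IsPiecewiseLipschitz γ f) :
    (∀ E : ℂ, 0 < RoughSchrodinger.lyapunov ω f E →
      ∀ τ : ℝ, 0 < τ → ∃ K : ℕ, RoughSchrodinger.IsThreshold ω γ f τ E K) ∧
    (∀ U : Set ℂ, IsCompact U → (∀ E ∈ U, 0 < RoughSchrodinger.lyapunov ω f E) →
      ContinuousOn (RoughSchrodinger.lyapunov ω f) U →
      ∀ τ : ℝ, 0 < τ → ∃ K : ℕ, ∀ E ∈ U, RoughSchrodinger.IsThreshold ω γ f τ E K) := by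
  refine ⟨fun E hE τ hτ => ?_, fun U hU hpos hcont τ hτ =>
    RoughSchrodinger.exists_isThreshold_of_isCompact hω hγ hf hU hpos hcont hτ⟩
  obtain ⟨K, hK⟩ := RoughSchrodinger.exists_isThreshold_of_isCompact hω hγ hf
    (isCompact_singleton (x := E)) (by simpa using hE) (continuousOn_singleton _ _) hτ
  exact ⟨K, hK E rfl⟩
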